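/- Let $G$ be a finite group and let $T$ be a $G$-Tambara functor, given levelwise by commutative rings $T(G/H)$ for $H\le G$, with restrictions $r^H_K$, transfers $t^H_K$, norms $N^H_K$ ($K\le H$) and conjugations $c_{g,H}\colon T(G/H)\cong T(G/gHg^{-1})$. A Tambara ideal $I$ of $T$ is a family of ideals $I(G/H)\subseteq T(G/H)$ with $r^H_K(I(G/H))\subseteq I(G/K)$, $t^H_K(I(G/K))\subseteq I(G/H)$, $N^H_K(I(G/K))\subseteq I(G/H)$ for $K\le H$, and $c_{g,H}(I(G/H))=I(G/gHg^{-1})$. Ideals are ordered by levelwise inclusion. The product $IJ$ is the smallest Tambara ideal containing all levelwise products $I(G/H)\cdot J(G/H)$, and $\langle x\rangle$ is the smallest Tambara ideal containing $x\in T(G/H)$. The radical of $I$ is given by $\sqrt I(G/H)=\{x\in T(G/H)\mid \langle x\rangle^n\subseteq I\text{ for some }n\ge 1\}$, and $I$ is radical if $I=\sqrt I$. An ideal $P$ is (Nakaoka) prime if $1\notin P(G/G)$ and, for all Tambara ideals $I,J$, $IJ\subseteq P$ implies $I\subseteq P$ or $J\subseteq P$. The Nakaoka spectrum $\mathrm{Spec}_{\mathrm{Nak}}(T)$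 is the set of primes, with the topology for which the sets $\{P\mid x\in P(G/H)\}$ ($H\le G$, $x\in T(G/H)$) form a subbasis of closed sets. Let $\mathrm{RadId}_G(T)$ be the set of radical Tambara ideals ordered by inclusion. A point of a frame $A$ is a frame homomorphism $p\colon A\to\{0<1\}$, and $\mathrm{pt}(A)$ is the set of points with the topology having the sets $U(a)=\{p\mid p(a)=1\}$, $a\in A$, as a basis. An element $q\neq\top$ of $A$ is meet-prime if $l\wedge m\le q$ implies $l\le q$ or $m\le q$. Theorem. $\mathrm{RadId}_G(T)$ is a frame, and there is a homeomorphism $$e\colon \mathrm{pt}(\mathrm{RadId}_G(T))\;\xrightarrow{\ \cong\ }\;\mathrm{Spec}_{\mathrm{Nak}}(T)$$ which sends a point $p$ to $\bigvee\{I\mid p(I)=0\}$, and whose inverse sends a prime $P$ to the point $p_P$ with $p_P(I)=1$ if and only if $I\not\subseteq P$. For every radical Tambara ideal $I$, it carries the basic open $U(I)$ onto $\{P\in\mathrm{Spec}_{\mathrm{Nak}}(T)\mid I\not\subseteq P\}$. Moreover, a Tambara ideal is prime if and only if it is radical and is a meet-prime element of $\mathrm{RadId}_G(T)$. -/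

import Mathlib

open scoped Pointwise

universe u v

/-- The conjugate subgroup `g H g⁻¹`. -/
def conjSubgroup {G : Type u} [Group G] (g : G) (H : Subgroup G) : Subgroup G :=
  H.map (MulAut.conj g).toMonoidHom

/-- `R` is a set of representatives of the double cosets `S \ A / L`, where `A` is a subset of `G`
(in practice stable under left translation by `S` and right translation by `L`). -/
def IsDoubleCosetReps {G : Type u} [Group G] (S : Subgroup G) (A : Set G) (L : Subgroup G)
    (R : Finset G) : Prop :=
  (∀ γ ∈ R, γ ∈ A) ∧ ∀ x ∈ A, ∃! γ, γ ∈ R ∧ ∃ s ∈ S, ∃ l ∈ L, x = s * γ * l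

/-- `𝓡` is a set of representatives of the orbits of `H`, acting by left translation, on the
family `F` of subsets of `G`. -/
def IsTranslationReps {G : Type u} [Group G] (H : Subgroup G) (F : Set (Set G))
    (𝓡 : Finset (Set G)) : Prop :=
  (∀ A ∈ 𝓡, A ∈ F) ∧ ∀ B ∈ F, ∃! A, A ∈ 𝓡 ∧ ∃ h ∈ H, B = h • A

/-- The stabilizer in `H` of a subset `A` of `G` under left translation. -/
def translationStab {G : Type u} [Group G] (H : Subgroup G) (A : Set G) : Subgroup G :=
  H ⊓ MulAction.stabilizer G A

lemma translationStab_le {G : Type u} [Group G] (H : Subgroup G) (A : Set G) :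
    translationStab H A ≤ H := inf_le_left

/-- Subsets of `H` that are unions of left cosets of `K`. For `K ≤ H` these are the functions
`s : H/K → {a, b}`, the set `A` being the union of the cosets where `s` takes the value `a`; left
translation by `H` is the usual action `(h s)(x) = s (h⁻¹ x)`. -/
def cosetUnions {G : Type u} [Group G] (H K : Subgroup G) : Set (Set G) :=
  {A | A ⊆ (H : Set G) ∧ ∀ x ∈ A, ∀ k ∈ K, x * k ∈ A}

/-- Subsets of `H` that are unions of left cosets of `L` and contain exactly one coset `x L` inside
each coset `h K`, `h ∈ H`. For `L ≤ K ≤ H` these are the sections `s : H/K → H/L` of the projection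
`H/L → H/K`, the set `A` being the union of the cosets in the image of `s`; left translation by `H`
is the action `(h s)(x) = h s (h⁻¹ x)`. -/
def cosetSections {G : Type u} [Group G] (H K L : Subgroup G) : Set (Set G) :=
  {A | A ⊆ (H : Set G) ∧ (∀ x ∈ A, ∀ l ∈ L, x * l ∈ A) ∧
    ∀ h ∈ H, ∃ x ∈ A, h⁻¹ * x ∈ K ∧ ∀ y ∈ A, h⁻¹ * y ∈ K → x⁻¹ * y ∈ L}

open Classical in
/-- A `G`-Tambara functor, given levelwise: `obj H` is the value `T(G/H)`, with restrictions `res`,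
transfers `tr`, norms `nm` and conjugations `conj`. The conjugation
`c_{g,H} : T(G/H) → T(G/gHg⁻¹)` is `conj g rfl`; its target is allowed to be written as any `H'`
with `H' = gHg⁻¹`. -/
structure TambaraFunctor (G : Type u) [Group G] where
  obj : Subgroup G → Type v
  [commRing : ∀ H, CommRing (obj H)]
  res : ∀ {K H : Subgroup G}, K ≤ H → (obj H →+* obj K)
  tr : ∀ {K H : Subgroup G}, K ≤ H → (obj K →+ obj H)
  nm : ∀ {K H : Subgroup G}, K ≤ H → (obj K →* obj H)
  conj : ∀ (g : G) {H H' : Subgroup G}, H' = conjSubgroup g H → (obj H ≃+* obj H')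
  -- functoriality
  res_refl : ∀ (H : Subgroup G) (x : obj H), res (le_refl H) x = x
  tr_refl : ∀ (H : Subgroup G) (x : obj H), tr (le_refl H) x = x
  nm_refl : ∀ (H : Subgroup G) (x : obj H), nm (le_refl H) x = x
  conj_of_mem : ∀ {H : Subgroup G} {h : G} (_ : h ∈ H) (e : H = conjSubgroup h H) (x : obj H),
    conj h e x = x
  res_res : ∀ {L K H : Subgroup G} (hLK : L ≤ K) (hKH : K ≤ H) (x : obj H),
    res hLK (res hKH x) = res (hLK.trans hKH) x
  tr_tr : ∀ {L K H : Subgroup G} (hLK : L ≤ K) (hKH : K ≤ H) (x : obj L),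
    tr hKH (tr hLK x) = tr (hLK.trans hKH) x
  nm_nm : ∀ {L K H : Subgroup G} (hLK : L ≤ K) (hKH : K ≤ H) (x : obj L),
    nm hKH (nm hLK x) = nm (hLK.trans hKH) x
  conj_conj : ∀ (g h : G) {H H' H'' : Subgroup G} (e : H' = conjSubgroup h H)
    (e' : H'' = conjSubgroup g H') (e'' : H'' = conjSubgroup (g * h) H) (x : obj H),
    conj g e' (conj h e x) = conj (g * h) e'' x
  -- compatibility with conjugation
  conj_res : ∀ (g : G) {K H K' H' : Subgroup G} (hKH : K ≤ H) (hKH' : K' ≤ H')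
    (eK : K' = conjSubgroup g K) (eH : H' = conjSubgroup g H) (x : obj H),
    conj g eK (res hKH x) = res hKH' (conj g eH x)
  conj_nm : ∀ (g : G) {K H K' H' : Subgroup G} (hKH : K ≤ H) (hKH' : K' ≤ H')
    (eK : K' = conjSubgroup g K) (eH : H' = conjSubgroup g H) (x : obj K),
    conj g eH (nm hKH x) = nm hKH' (conj g eK x)
  conj_tr : ∀ (g : G) {K H K' H' : Subgroup G} (hKH : K ≤ H) (hKH' : K' ≤ H')
    (eK : K' = conjSubgroup g K) (eH : H' = conjSubgroup g H) (x : obj K),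
    conj g eH (tr hKH x) = tr hKH' (conj g eK x)
  -- additive and multiplicative double coset formulas
  res_tr : ∀ {H L K : Subgroup G} (hHK : H ≤ K) (hLK : L ≤ K) (R : Finset G),
    IsDoubleCosetReps L (K : Set G) H R → ∀ a : obj H,
      res hLK (tr hHK a) = ∑ γ ∈ R,
        tr (inf_le_left : L ⊓ conjSubgroup γ H ≤ L)
          (res (inf_le_right : L ⊓ conjSubgroup γ H ≤ conjSubgroup γ H) (conj γ rfl a))
  res_nm : ∀ {H L K : Subgroup G} (hHK : H ≤ K) (hLK : L ≤ K) (R : Finset G),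
    IsDoubleCosetReps L (K : Set G) H R → ∀ a : obj H,
      res hLK (nm hHK a) = ∏ γ ∈ R,
        nm (inf_le_left : L ⊓ conjSubgroup γ H ≤ L)
          (res (inf_le_right : L ⊓ conjSubgroup γ H ≤ conjSubgroup γ H) (conj γ rfl a))
  -- Frobenius reciprocity
  tr_res_mul : ∀ {K H : Subgroup G} (hKH : K ≤ H) (x : obj H) (y : obj K),
    tr hKH (res hKH x * y) = x * tr hKH y
  -- Tambara reciprocity for sums: the sum runs over the `H`-orbits of functions
  -- `H/K → {a, b}`, the inner product over the orbits of the stabilizer on `H/K`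
  nm_add : ∀ {K H : Subgroup G} (hKH : K ≤ H) (𝓡 : Finset (Set G)) (R : Set G → Finset G),
    IsTranslationReps H (cosetUnions H K) 𝓡 →
    (∀ A ∈ 𝓡, IsDoubleCosetReps (translationStab H A) (H : Set G) K (R A)) →
    ∀ a b : obj K,
      nm hKH (a + b) = ∑ A ∈ 𝓡, tr (translationStab_le H A) (∏ γ ∈ R A,
        nm (inf_le_left : translationStab H A ⊓ conjSubgroup γ K ≤ translationStab H A)
          (res (inf_le_right : translationStab H A ⊓ conjSubgroup γ K ≤ conjSubgroup γ K)
            (conj γ rfl (if γ ∈ A then a else b))))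
  -- Tambara reciprocity for transfers: the sum runs over the `H`-orbits of sections
  -- `s : H/K → H/L`, the inner product over the orbits of the stabilizer on the image of `s`
  -- (which correspond to its orbits on `H/K`)
  nm_tr : ∀ {L K H : Subgroup G} (hLK : L ≤ K) (hKH : K ≤ H) (𝓡 : Finset (Set G))
    (R : Set G → Finset G),
    IsTranslationReps H (cosetSections H K L) 𝓡 →
    (∀ A ∈ 𝓡, IsDoubleCosetReps (translationStab H A) A L (R A)) →
    ∀ a : obj L,
      nm hKH (tr hLK a) = ∑ A ∈ 𝓡, tr (translationStab_le H A) (∏ γ ∈ R A,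
        nm (inf_le_left : translationStab H A ⊓ conjSubgroup γ L ≤ translationStab H A)
          (res (inf_le_right : translationStab H A ⊓ conjSubgroup γ L ≤ conjSubgroup γ L)
            (conj γ rfl a)))

attribute [instance] TambaraFunctor.commRing

/-- A Tambara ideal of `T`. -/
@[ext]
structure TambaraIdeal {G : Type u} [Group G] (T : TambaraFunctor.{u, v} G) where
  level : ∀ H : Subgroup G, Ideal (T.obj H)
  res_mem : ∀ {K H : Subgroup G} (hKH : K ≤ H) {x : T.obj H}, x ∈ level H → T.res hKH x ∈ level K
  tr_mem : ∀ {K H : Subgroup G} (hKH : K ≤ H) {x : T.obj K}, x ∈ level K → T.tr hKH x ∈ level H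
  nm_mem : ∀ {K H : Subgroup G} (hKH : K ≤ H) {x : T.obj K}, x ∈ level K → T.nm hKH x ∈ level H
  conj_image : ∀ (g : G) {H H' : Subgroup G} (e : H' = conjSubgroup g H),
    T.conj g e '' (level H : Set (T.obj H)) = (level H' : Set (T.obj H'))

namespace TambaraIdeal

variable {G : Type u} [Group G] {T : TambaraFunctor.{u, v} G}

/-- Tambara ideals are ordered by levelwise inclusion. -/
instance : PartialOrder (TambaraIdeal T) :=
  PartialOrder.lift (fun I => I.level) fun _ _ h => TambaraIdeal.ext h

/-- Levelwise intersection. -/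
instance : InfSet (TambaraIdeal T) where
  sInf S :=
    { level := fun H => ⨅ I ∈ S, I.level H
      res_mem := by
        intro K H hKH x hx
        simp only [Submodule.mem_iInf] at hx ⊢
        exact fun I hI => I.res_mem hKH (hx I hI)
      tr_mem := by
        intro K H hKH x hx
        simp only [Submodule.mem_iInf] at hx ⊢
        exact fun I hI => I.tr_mem hKH (hx I hI)
      nm_mem := by
        intro K H hKH x hx
        simp only [Submodule.mem_iInf] at hx ⊢
        exact fun I hI => I.nm_mem hKH (hx I hI)
      conj_image := by
        intro g H H' e
        ext y
        simp only [Set.mem_image, SetLike.mem_coe, Submodule.mem_iInf]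
        constructor
        · rintro ⟨x, hx, rfl⟩ I hI
          exact (I.conj_image g e).subset ⟨x, hx I hI, rfl⟩
        · intro hy
          refine ⟨(T.conj g e).symm y, fun I hI => ?_, by simp⟩
          obtain ⟨x, hx, rfl⟩ := (I.conj_image g e).superset (hy I hI)
          simpa using hx }

lemma mem_sInf_level {S : Set (TambaraIdeal T)} {H : Subgroup G} {x : T.obj H} :
    x ∈ (sInf S).level H ↔ ∀ I ∈ S, x ∈ I.level H := by
  change x ∈ ⨅ I ∈ S, I.level H ↔ _
  simp only [Submodule.mem_iInf]

lemma isGLB_sInf (S : Set (TambaraIdeal T)) : IsGLB S (sInf S) :=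
  ⟨fun I hI _ _ hx => mem_sInf_level.1 hx I hI,
    fun _ hJ H _ hx => mem_sInf_level.2 fun _ hI => hJ hI H hx⟩

/-- The whole functor `T`, as a Tambara ideal. -/
def whole (T : TambaraFunctor.{u, v} G) : TambaraIdeal T where
  level := fun _ => ⊤
  res_mem := fun _ _ _ => trivial
  tr_mem := fun _ _ _ => trivial
  nm_mem := fun _ _ _ => trivial
  conj_image := fun g _ _ e => by
    simp

/-- The Tambara ideal generated by subsets of the levels. -/
def generate (X : ∀ H : Subgroup G, Set (T.obj H)) : TambaraIdeal T :=
  sInf {I | ∀ H, X H ⊆ (I.level H : Set (T.obj H))}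

/-- The Tambara ideal `⟨x⟩` generated by one element `x ∈ T(G/H)`. -/
def principal {H : Subgroup G} (x : T.obj H) : TambaraIdeal T :=
  sInf {I | x ∈ I.level H}

/-- The product of two Tambara ideals: the Tambara ideal generated by the levelwise products. -/
def prod (I J : TambaraIdeal T) : TambaraIdeal T :=
  generate fun H => ((I.level H * J.level H : Ideal (T.obj H)) : Set (T.obj H))

/-- The `n`-fold product of a Tambara ideal with itself (only used for `n ≥ 1`). -/
def npow (I : TambaraIdeal T) : ℕ → TambaraIdeal T
  | 0 => whole T
  | 1 => I
  | n + 2 => prod (npow I (n + 1)) I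

/-- A Tambara ideal is proper if `1 ∉ I(G/G)`. -/
def IsProper (I : TambaraIdeal T) : Prop :=
  (1 : T.obj ⊤) ∉ I.level ⊤

/-- Nakaoka's prime ideals. -/
def IsPrime (P : TambaraIdeal T) : Prop :=
  P.IsProper ∧ ∀ I J : TambaraIdeal T, prod I J ≤ P → I ≤ P ∨ J ≤ P

/-- The level at `G/H` of the radical `√I`, as a subset of `T(G/H)`. -/
def radicalSet (I : TambaraIdeal T) (H : Subgroup G) : Set (T.obj H) :=
  {x | ∃ n : ℕ, 1 ≤ n ∧ npow (principal x) n ≤ I}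

/-- A Tambara ideal is radical if `I = √I`. -/
def IsRadical (I : TambaraIdeal T) : Prop :=
  ∀ H : Subgroup G, (I.level H : Set (T.obj H)) = radicalSet I H

lemma mem_principal {H : Subgroup G} (x : T.obj H) : x ∈ (principal x).level H :=
  mem_sInf_level.2 fun _ hI => hI

lemma principal_le {H : Subgroup G} {x : T.obj H} {I : TambaraIdeal T} (hx : x ∈ I.level H) :
    principal x ≤ I :=
  (isGLB_sInf _).1 hx

/-- Levelwise intersections of radical Tambara ideals are radical. -/
lemma isRadical_sInf {S : Set (TambaraIdeal T)} (hS : ∀ I ∈ S, I.IsRadical) :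
    (sInf S).IsRadical := by
  intro H
  ext x
  constructor
  · intro hx
    exact ⟨1, le_rfl, principal_le hx⟩
  · rintro ⟨n, hn, hle⟩
    refine mem_sInf_level.2 fun I hI => ?_
    exact (hS I hI H).superset ⟨n, hn, hle.trans ((isGLB_sInf S).1 hI)⟩

end TambaraIdeal

/-- The poset `RadId_G(T)` of radical Tambara ideals, ordered by inclusion. -/
abbrev RadicalTambaraIdeal {G : Type u} [Group G] (T : TambaraFunctor.{u, v} G) :=
  {I : TambaraIdeal T // I.IsRadical}

/-- The complete lattice structure on `RadId_G(T)` for the inclusion order, obtained from the fact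
that levelwise intersections of radical Tambara ideals are radical. -/
noncomputable instance {G : Type u} [Group G] (T : TambaraFunctor.{u, v} G) :
    CompleteLattice (RadicalTambaraIdeal T) :=
  letI : InfSet (RadicalTambaraIdeal T) :=
    ⟨fun S => ⟨sInf (Subtype.val '' S), TambaraIdeal.isRadical_sInf (by
      rintro _ ⟨I, _, rfl⟩
      exact I.2)⟩⟩
  completeLatticeOfInf (RadicalTambaraIdeal T) fun S =>
    ⟨fun I hI => (TambaraIdeal.isGLB_sInf (Subtype.val '' S)).1 ⟨I, hI, rfl⟩,
      fun J hJ => (TambaraIdeal.isGLB_sInf (Subtype.val '' S)).2 (by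
        rintro _ ⟨I, hI, rfl⟩
        exact hJ hI)⟩

/-- The set `Spec_Nak(T)` of prime Tambara ideals. -/
def NakaokaSpectrum {G : Type u} [Group G] (T : TambaraFunctor.{u, v} G) :=
  {P : TambaraIdeal T // P.IsPrime}

/-- The Nakaoka topology: the sets `V_H(x) = {P | x ∈ P(G/H)}` are a subbasis of closed sets. -/
instance {G : Type u} [Group G] (T : TambaraFunctor.{u, v} G) :
    TopologicalSpace (NakaokaSpectrum T) :=
  TopologicalSpace.generateFrom
    {U | ∃ (H : Subgroup G) (x : T.obj H), U = {P : NakaokaSpectrum T | x ∈ P.1.level H}ᶜ}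

/-! Everything rests on an ideal quotient `(P : J)`: the elements `x` with `⟨x⟩J ⊆ P` form a Tambara
ideal, characterised by `I ⊆ (P : J) ↔ IJ ⊆ P` (`le_colon_iff`). Only closure under addition is
delicate. It uses `⟨x + y⟩ ⊆ ⟨x⟩ + ⟨y⟩`, where the levelwise sum is a Tambara ideal because the norm
of a sum splits by Tambara reciprocity (`nm_add_mem_sup`).

If `P` is radical, then so is `(P : J)`, and for radical `I`, `J` the conditions `I ∩ J ⊆ P` and `IJ
⊆ P` agree (`inf_le_iff_prod_le`). Hence meeting with `I` has a right adjoint on radical ideals,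
which gives the frame law, and Nakaoka primes are the meet-primes. The homeomorphism is then the
usual correspondence between points of a complete lattice and its meet-prime elements, with the
topologies compared through radical ideals generated by one element. -/

/-! ### Orbit and double coset representatives -/

lemma exists_finset_reps {α : Type*} [Finite α] (s : Setoid α) (F : Set α) :
    ∃ R : Finset α, (∀ a ∈ R, a ∈ F) ∧ ∀ x ∈ F, ∃! a, a ∈ R ∧ s x a := by
  classical
  let t : Setoid F := s.comap Subtype.val
  refine ⟨(Set.range fun q : Quotient t => (q.out : α)).toFinite.toFinset, ?_, ?_⟩
  · intro a ha
    obtain ⟨q, rfl⟩ := by simpa using ha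
    exact q.out.2
  · intro x hx
    refine ⟨((Quotient.mk t ⟨x, hx⟩).out : α), ⟨by simp, ?_⟩, ?_⟩
    · exact s.symm (Quotient.mk_out (s := t) ⟨x, hx⟩)
    · rintro a ⟨ha, hxa⟩
      obtain ⟨q, rfl⟩ := by simpa using ha
      have : Quotient.mk t ⟨x, hx⟩ = q := by
        rw [← Quotient.out_eq q]
        exact Quotient.sound hxa
      rw [this]

lemma exists_isDoubleCosetReps {G : Type u} [Group G] [Finite G] (S : Subgroup G) (A : Set G)
    (L : Subgroup G) : ∃ R : Finset G, IsDoubleCosetReps S A L R :=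
  exists_finset_reps
    { r := fun x y => ∃ s ∈ S, ∃ l ∈ L, x = s * y * l
      iseqv :=
        { refl := fun x => ⟨1, S.one_mem, 1, L.one_mem, by simp⟩
          symm := by
            rintro x y ⟨s, hs, l, hl, rfl⟩
            exact ⟨s⁻¹, S.inv_mem hs, l⁻¹, L.inv_mem hl, by group⟩
          trans := by
            rintro x y z ⟨s, hs, l, hl, rfl⟩ ⟨s', hs', l', hl', rfl⟩
            exact ⟨s * s', S.mul_mem hs hs', l' * l, L.mul_mem hl' hl, by group⟩ } } A

lemma exists_isTranslationReps {G : Type u} [Group G] [Finite G] (H : Subgroup G)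
    (F : Set (Set G)) : ∃ R : Finset (Set G), IsTranslationReps H F R :=
  exists_finset_reps
    { r := fun A B => ∃ h ∈ H, A = h • B
      iseqv :=
        { refl := fun A => ⟨1, H.one_mem, by simp⟩
          symm := by
            rintro A B ⟨h, hh, rfl⟩
            exact ⟨h⁻¹, H.inv_mem hh, by simp⟩
          trans := by
            rintro A B C ⟨h, hh, rfl⟩ ⟨h', hh', rfl⟩
            exact ⟨h * h', H.mul_mem hh hh', by rw [mul_smul]⟩ } } F

/-! ### Sums, products and quotients of Tambara ideals -/

namespace TambaraIdeal

variable {G : Type u} [Group G] {T : TambaraFunctor.{u, v} G}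

lemma conj_mem (I : TambaraIdeal T) (g : G) {H H' : Subgroup G} (e : H' = conjSubgroup g H)
    {x : T.obj H} (hx : x ∈ I.level H) : T.conj g e x ∈ I.level H' :=
  (I.conj_image g e).subset ⟨x, hx, rfl⟩

lemma mem_of_conj_mem (I : TambaraIdeal T) (g : G) {H H' : Subgroup G} (e : H' = conjSubgroup g H)
    {x : T.obj H} (hx : T.conj g e x ∈ I.level H') : x ∈ I.level H := by
  obtain ⟨y, hy, hxy⟩ := (I.conj_image g e).superset hx
  rwa [← (T.conj g e).injective hxy]

/-- A factor in an ideal puts every product of norms of restrictions of conjugates containing it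
into that ideal. -/
lemma prod_nm_res_conj_mem (I : TambaraIdeal T) {S K : Subgroup G} {R : Finset G}
    (f : G → T.obj K) {γ : G} (hγ : γ ∈ R) (hf : f γ ∈ I.level K) :
    (∏ γ ∈ R, T.nm (inf_le_left : S ⊓ conjSubgroup γ K ≤ S)
      (T.res (inf_le_right : S ⊓ conjSubgroup γ K ≤ conjSubgroup γ K)
        (T.conj γ rfl (f γ)))) ∈ I.level S :=
  Ideal.mem_of_dvd _ (Finset.dvd_prod_of_mem _ hγ)
    (I.nm_mem _ (I.res_mem _ (I.conj_mem γ rfl hf)))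

/-- Each summand in the reciprocity formula is the transfer of a product whose factors come from `a`
or from `b`. A single factor decides: it puts the whole summand in `I` or in `J`. -/
lemma nm_add_mem_sup [Finite G] (I J : TambaraIdeal T) {K H : Subgroup G} (hKH : K ≤ H)
    {a b : T.obj K} (ha : a ∈ I.level K) (hb : b ∈ J.level K) :
    T.nm hKH (a + b) ∈ I.level H ⊔ J.level H := by
  classical
  obtain ⟨𝓡, h𝓡⟩ := exists_isTranslationReps H (cosetUnions H K)
  choose R hR using fun A : Set G =>
    exists_isDoubleCosetReps (translationStab H A) (H : Set G) K
  rw [T.nm_add hKH 𝓡 R h𝓡 fun A _ => hR A]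
  refine sum_mem fun A _ => ?_
  -- The double coset of `1` has a representative, so the product is not empty.
  obtain ⟨γ, ⟨hγ, -⟩, -⟩ := (hR A).2 1 H.one_mem
  by_cases h : γ ∈ A
  · exact Ideal.mem_sup_left (I.tr_mem _ (I.prod_nm_res_conj_mem _ hγ (by
      rw [if_pos h]; exact ha)))
  · exact Ideal.mem_sup_right (J.tr_mem _ (J.prod_nm_res_conj_mem _ hγ (by
      rw [if_neg h]; exact hb)))

/-- The levelwise sum of two Tambara ideals. -/
def add [Finite G] (I J : TambaraIdeal T) : TambaraIdeal T where
  level H := I.level H ⊔ J.level H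
  res_mem hKH x hx := by
    obtain ⟨a, ha, b, hb, rfl⟩ := Submodule.mem_sup.1 hx
    rw [map_add]
    exact Submodule.add_mem_sup (I.res_mem hKH ha) (J.res_mem hKH hb)
  tr_mem hKH x hx := by
    obtain ⟨a, ha, b, hb, rfl⟩ := Submodule.mem_sup.1 hx
    rw [map_add]
    exact Submodule.add_mem_sup (I.tr_mem hKH ha) (J.tr_mem hKH hb)
  nm_mem hKH x hx := by
    obtain ⟨a, ha, b, hb, rfl⟩ := Submodule.mem_sup.1 hx
    exact nm_add_mem_sup I J hKH ha hb
  conj_image g H H' e := by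
    ext y
    constructor
    · rintro ⟨x, hx, rfl⟩
      obtain ⟨a, ha, b, hb, rfl⟩ := Submodule.mem_sup.1 hx
      rw [map_add]
      exact Submodule.add_mem_sup (I.conj_mem g e ha) (J.conj_mem g e hb)
    · intro hy
      obtain ⟨a, ha, b, hb, rfl⟩ := Submodule.mem_sup.1 hy
      obtain ⟨a, ha', rfl⟩ := (I.conj_image g e).superset ha
      obtain ⟨b, hb', rfl⟩ := (J.conj_image g e).superset hb
      refine ⟨a + b, ?_, map_add _ _ _⟩
      exact Submodule.add_mem_sup ha' hb'

lemma prod_le_iff {I J P : TambaraIdeal T} :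
    prod I J ≤ P ↔ ∀ H, ∀ x ∈ I.level H, ∀ y ∈ J.level H, x * y ∈ P.level H := by
  constructor
  · intro h H x hx y hy
    exact h H (mem_sInf_level.2 fun Q hQ => hQ H (Ideal.mul_mem_mul hx hy))
  · intro h
    exact (isGLB_sInf _).1 fun H => Ideal.mul_le.2 (h H)

lemma prod_comm (I J : TambaraIdeal T) : prod I J = prod J I := by
  unfold prod
  simp only [mul_comm]

lemma prod_mono {I I' J J' : TambaraIdeal T} (hI : I ≤ I') (hJ : J ≤ J') :
    prod I J ≤ prod I' J' :=
  prod_le_iff.2 fun H _ hx _ hy => prod_le_iff.1 le_rfl H _ (hI H hx) _ (hJ H hy)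

lemma prod_le_left (I J : TambaraIdeal T) : prod I J ≤ I :=
  prod_le_iff.2 fun _ _ hx y _ => Ideal.mul_mem_right y _ hx

lemma prod_le_right (I J : TambaraIdeal T) : prod I J ≤ J :=
  prod_comm I J ▸ prod_le_left J I

lemma npow_mono {I J : TambaraIdeal T} (h : I ≤ J) : ∀ n, npow I n ≤ npow J n
  | 0 => le_rfl
  | 1 => h
  | n + 2 => prod_mono (npow_mono h (n + 1)) h

lemma npow_succ_eq_prod (I : TambaraIdeal T) {n : ℕ} (hn : 1 ≤ n) :
    npow I (n + 1) = prod (npow I n) I := by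
  obtain ⟨n, rfl⟩ := Nat.exists_eq_add_of_le' hn
  rfl

lemma le_iff_forall_mem {I J : TambaraIdeal T} : I ≤ J ↔ ∀ H, ∀ x ∈ I.level H, x ∈ J.level H :=
  Iff.rfl

lemma add_prod_le [Finite G] {I I' J P : TambaraIdeal T} (h : prod I J ≤ P) (h' : prod I' J ≤ P) :
    prod (add I I') J ≤ P := by
  refine prod_le_iff.2 fun H x hx y hy => ?_
  obtain ⟨a, ha, b, hb, rfl⟩ := Submodule.mem_sup.1 hx
  rw [add_mul]
  exact add_mem (prod_le_iff.1 h H a ha y hy) (prod_le_iff.1 h' H b hb y hy)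

/-- The ideal quotient `(P : J)`, the largest Tambara ideal whose product with `J` lies in `P`. -/
def colon [Finite G] (P J : TambaraIdeal T) : TambaraIdeal T where
  level H :=
    { carrier := {x | prod (principal x) J ≤ P}
      zero_mem' := (prod_le_left _ _).trans (principal_le (zero_mem _))
      add_mem' := fun {x y} hx hy => by
        -- `⟨x + y⟩ ⊆ ⟨x⟩ + ⟨y⟩`, since the levelwise sum is itself a Tambara ideal.
        refine (prod_mono (principal_le ?_) le_rfl).trans (add_prod_le hx hy)
        exact Submodule.add_mem_sup (mem_principal x) (mem_principal y)
      smul_mem' := fun a x hx =>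
        (prod_mono (principal_le (Ideal.mul_mem_left _ a (mem_principal x))) le_rfl).trans hx }
  res_mem hKH x hx :=
    (prod_mono (principal_le (res_mem _ hKH (mem_principal x))) le_rfl).trans hx
  tr_mem hKH x hx :=
    (prod_mono (principal_le (tr_mem _ hKH (mem_principal x))) le_rfl).trans hx
  nm_mem hKH x hx :=
    (prod_mono (principal_le (nm_mem _ hKH (mem_principal x))) le_rfl).trans hx
  conj_image g _ _ e := by
    ext y
    constructor
    · rintro ⟨x, hx, rfl⟩
      exact (prod_mono (principal_le (conj_mem _ g e (mem_principal x))) le_rfl).trans hx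
    · intro hy
      obtain ⟨x, rfl⟩ := (T.conj g e).surjective y
      refine ⟨x, ?_, rfl⟩
      exact (prod_mono (principal_le (mem_of_conj_mem _ g e (mem_principal _))) le_rfl).trans hy

lemma le_colon_iff [Finite G] {I J P : TambaraIdeal T} : I ≤ colon P J ↔ prod I J ≤ P := by
  constructor
  · intro h
    exact prod_le_iff.2 fun H x hx y hy => prod_le_iff.1 (h H hx) H x (mem_principal x) y hy
  · intro h H x hx
    exact (prod_mono (principal_le hx) le_rfl).trans h

lemma IsRadical.mem_of_npow_le {P : TambaraIdeal T} (hP : P.IsRadical) {H : Subgroup G}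
    {x : T.obj H} {n : ℕ} (hn : 1 ≤ n) (h : npow (principal x) n ≤ P) : x ∈ P.level H :=
  (hP H).superset ⟨n, hn, h⟩

lemma isRadical_of_forall {P : TambaraIdeal T}
    (h : ∀ (H : Subgroup G) (x : T.obj H) (n : ℕ), 1 ≤ n → npow (principal x) n ≤ P →
      x ∈ P.level H) : P.IsRadical := fun H =>
  Set.Subset.antisymm (fun _ hx => ⟨1, le_rfl, principal_le hx⟩)
    fun x ⟨n, hn, hx⟩ => h H x n hn hx

lemma isRadical_whole : (whole T).IsRadical :=
  isRadical_of_forall fun _ _ _ _ _ => trivial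

/-- Suppose `⟨x⟩ⁿ ⊆ (P : J)`. For `a ∈ ⟨x⟩` and `b ∈ J`, the element `ab` lies in both ideals, so
`⟨ab⟩ⁿ⁺¹ ⊆ ⟨x⟩ⁿJ ⊆ P` and `ab ∈ P`. -/
lemma IsRadical.colon [Finite G] {P : TambaraIdeal T} (hP : P.IsRadical) (J : TambaraIdeal T) :
    (P.colon J).IsRadical := by
  refine isRadical_of_forall fun H x n hn hx => ?_
  refine prod_le_iff.2 fun K a ha b hb => hP.mem_of_npow_le (Nat.le_add_left 1 n) ?_
  rw [npow_succ_eq_prod _ hn]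
  exact (prod_mono (npow_mono (principal_le (Ideal.mul_mem_right b _ ha)) n)
    (principal_le (Ideal.mul_mem_left _ a hb))).trans (le_colon_iff.1 hx)

lemma IsProper.not_whole_le {P : TambaraIdeal T} (h : P.IsProper) : ¬ whole T ≤ P :=
  fun hle => h (hle ⊤ trivial)

lemma isProper_of_not_whole_le {P : TambaraIdeal T} (h : ¬ whole T ≤ P) : P.IsProper := by
  intro h1
  refine h (le_iff_forall_mem.2 fun H x _ => ?_)
  -- Restriction carries `1` at `G/G` to `1` at every level.
  have := P.res_mem (le_top : H ≤ ⊤) h1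
  rw [map_one] at this
  rw [Ideal.eq_top_of_isUnit_mem _ this isUnit_one]
  trivial

lemma IsPrime.le_of_npow_le {P I : TambaraIdeal T} (hP : P.IsPrime) :
    ∀ {n : ℕ}, 1 ≤ n → npow I n ≤ P → I ≤ P
  | 1, _, h => h
  | n + 2, _, h => (hP.2 _ _ h).elim (hP.le_of_npow_le (Nat.le_add_left 1 n)) id

lemma IsPrime.isRadical {P : TambaraIdeal T} (hP : P.IsPrime) : P.IsRadical :=
  isRadical_of_forall fun H x _ hn h => hP.le_of_npow_le hn h H (mem_principal x)

end TambaraIdeal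

/-! ### The frame of radical ideals and its meet-primes -/

namespace RadicalTambaraIdeal

open TambaraIdeal

variable {G : Type u} [Group G] {T : TambaraFunctor.{u, v} G}

/-- The product always lies in the intersection; conversely `x ∈ I ∩ J` gives `⟨x⟩² ⊆ IJ ⊆ P`, hence
`x ∈ P`. -/
lemma inf_le_iff_prod_le {I J P : RadicalTambaraIdeal T} :
    I ⊓ J ≤ P ↔ TambaraIdeal.prod I.1 J.1 ≤ P.1 := by
  constructor
  · intro h
    let Q : RadicalTambaraIdeal T :=
      ⟨sInf {I.1, J.1}, isRadical_sInf (by rintro _ (rfl | rfl); exacts [I.2, J.2])⟩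
    have hQ : Q ≤ I ⊓ J := le_inf ((TambaraIdeal.isGLB_sInf _).1 (.inl rfl)) ((TambaraIdeal.isGLB_sInf _).1 (.inr rfl))
    refine le_trans ?_ (hQ.trans h)
    refine (TambaraIdeal.isGLB_sInf _).2 ?_
    rintro _ (rfl | rfl)
    exacts [prod_le_left _ _, prod_le_right _ _]
  · intro h H x hx
    exact P.2.mem_of_npow_le one_le_two <|
      (prod_mono (principal_le ((inf_le_left : I ⊓ J ≤ I) H hx))
        (principal_le ((inf_le_right : I ⊓ J ≤ J) H hx))).trans h

/-- With `P` the right-hand side, every `J ∈ S` lies in the radical ideal `(P : I)`, hence so does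
their join. -/
theorem inf_sSup_eq_iSup [Finite G] (I : RadicalTambaraIdeal T)
    (S : Set (RadicalTambaraIdeal T)) : I ⊓ sSup S = ⨆ J ∈ S, I ⊓ J := by
  refine le_antisymm ?_ iSup_inf_le_inf_sSup
  set P := ⨆ J ∈ S, I ⊓ J
  rw [inf_le_iff_prod_le, prod_comm, ← le_colon_iff]
  have : sSup S ≤ ⟨P.1.colon I.1, P.2.colon I.1⟩ := sSup_le fun J hJ => by
    refine le_colon_iff.2 ?_
    rw [prod_comm, ← inf_le_iff_prod_le]
    exact le_iSup₂_of_le J hJ le_rfl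
  exact this

theorem isPrime_iff_infPrime [Finite G] (P : RadicalTambaraIdeal T) :
    P.1.IsPrime ↔ InfPrime P := by
  constructor
  · intro hP
    refine ⟨fun hmax => hP.1.not_whole_le ?_, fun I J h => hP.2 _ _ (inf_le_iff_prod_le.1 h)⟩
    exact hmax (b := ⟨whole T, isRadical_whole⟩) fun _ _ _ => trivial
  · rintro ⟨hmax, hP⟩
    refine ⟨isProper_of_not_whole_le fun h => hmax fun Q _ =>
      le_trans (b := whole T) (fun _ _ _ => trivial) h, ?_⟩
    intro I J hIJ
    -- Meet-primality only tests radical ideals, but `I` and `J` are arbitrary. They are enlarged to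
    -- `Q = (P : J) ⊇ I` and `R = (P : Q) ⊇ J`, which are radical and still satisfy `QR ⊆ P`.
    let Q : RadicalTambaraIdeal T := ⟨P.1.colon J, P.2.colon J⟩
    let R : RadicalTambaraIdeal T := ⟨P.1.colon Q.1, P.2.colon Q.1⟩
    have hQ : TambaraIdeal.prod J Q.1 ≤ P.1 := prod_comm J Q.1 ▸ le_colon_iff.1 le_rfl
    have hQR : Q ⊓ R ≤ P := by
      rw [inf_le_iff_prod_le, prod_comm]
      exact le_colon_iff.1 le_rfl
    exact (hP hQR).imp (le_trans (le_colon_iff.2 hIJ)) (le_trans (le_colon_iff.2 hQ))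

theorem isPrime_iff [Finite G] (P : TambaraIdeal T) :
    P.IsPrime ↔ ∃ h : P.IsRadical, InfPrime (⟨P, h⟩ : RadicalTambaraIdeal T) :=
  ⟨fun hP => ⟨hP.isRadical, (isPrime_iff_infPrime ⟨P, hP.isRadical⟩).1 hP⟩,
    fun ⟨h, hP⟩ => (isPrime_iff_infPrime ⟨P, h⟩).2 hP⟩

end RadicalTambaraIdeal

/-! ### Points of a complete lattice and meet-primes -/

namespace Locale.PT

variable {L : Type*} [CompleteLattice L]

/-- The largest element at which a point vanishes. -/
def kernel (p : Locale.PT L) : L := sSup {a | ¬ p a}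

/-- A point preserves joins, so it still vanishes at its kernel, and by monotonicity at everything
below. -/
lemma apply_iff_not_le_kernel (p : Locale.PT L) (a : L) : p a ↔ ¬ a ≤ p.kernel := by
  have hk : ¬ p p.kernel := by
    rw [kernel, map_sSup]
    rintro ⟨_, ⟨a, ha, rfl⟩, hpa⟩
    exact ha hpa
  refine ⟨fun ha hle => hk (OrderHomClass.mono p hle ha), fun h => ?_⟩
  by_contra ha
  exact h (le_sSup ha)

lemma infPrime_kernel (p : Locale.PT L) : InfPrime p.kernel := by
  have h := p.apply_iff_not_le_kernel
  constructor
  · intro hmax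
    have : p ⊤ := by rw [map_top]; trivial
    exact (h ⊤).1 this (hmax le_top)
  · intro a b hab
    by_contra! hcon
    have : p (a ⊓ b) := by
      rw [map_inf]
      exact ⟨(h a).2 hcon.1, (h b).2 hcon.2⟩
    exact (h _).1 this hab

/-- The point attached to a meet-prime element. -/
def ofInfPrime (q : L) (hq : InfPrime q) : Locale.PT L where
  toFun a := ¬ a ≤ q
  map_inf' a b := by
    simp only [hq.inf_le, not_or]
    rfl
  map_top' := eq_true fun h => hq.1 fun _ _ => le_top.trans h
  map_sSup' S := by
    refine propext ⟨fun h => ?_, ?_⟩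
    · obtain ⟨a, ha, haq⟩ : ∃ a ∈ S, ¬ a ≤ q := by simpa [sSup_le_iff] using h
      exact ⟨_, ⟨a, ha, rfl⟩, haq⟩
    · rintro ⟨_, ⟨a, ha, rfl⟩, haq⟩ h
      exact haq ((le_sSup ha).trans h)

lemma kernel_ofInfPrime (q : L) (hq : InfPrime q) : (ofInfPrime q hq).kernel = q := by
  have h : ∀ a, a ≤ (ofInfPrime q hq).kernel ↔ a ≤ q := fun a =>
    not_iff_not.1 ((apply_iff_not_le_kernel _ a).symm)
  exact le_antisymm ((h _).1 le_rfl) ((h _).2 le_rfl)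

end Locale.PT

/-! ### Comparison of the topologies -/

namespace NakaokaSpectrum

open TambaraIdeal

variable {G : Type u} [Group G] {T : TambaraFunctor.{u, v} G}

lemma isOpen_not_le (I : TambaraIdeal T) : IsOpen {P : NakaokaSpectrum T | ¬ I ≤ P.1} := by
  have : {P : NakaokaSpectrum T | ¬ I ≤ P.1} =
      ⋃ (H : Subgroup G) (x ∈ I.level H), {P : NakaokaSpectrum T | x ∈ P.1.level H}ᶜ := by
    ext P
    simp [le_iff_forall_mem]
  rw [this]
  exact isOpen_iUnion fun H => isOpen_iUnion fun x => isOpen_iUnion fun _ =>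
    TopologicalSpace.isOpen_generateFrom_of_mem ⟨H, x, rfl⟩

variable [Finite G]

/-- The homeomorphism from the points of the frame of radical Tambara ideals to the Nakaoka
spectrum. -/
noncomputable def ptHomeomorph (T : TambaraFunctor.{u, v} G) :
    Locale.PT (RadicalTambaraIdeal T) ≃ₜ NakaokaSpectrum T where
  toFun p := ⟨p.kernel.1, (RadicalTambaraIdeal.isPrime_iff_infPrime _).2 p.infPrime_kernel⟩
  invFun P := Locale.PT.ofInfPrime ⟨P.1, P.2.isRadical⟩
    ((RadicalTambaraIdeal.isPrime_iff_infPrime _).1 P.2)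
  left_inv p := FrameHom.ext fun I => propext (p.apply_iff_not_le_kernel I).symm
  right_inv P := Subtype.ext (congrArg (Subtype.val : RadicalTambaraIdeal T → TambaraIdeal T)
    (Locale.PT.kernel_ofInfPrime _ ((RadicalTambaraIdeal.isPrime_iff_infPrime _).1 P.2)))
  continuous_toFun := by
    refine continuous_generateFrom_iff.2 ?_
    rintro _ ⟨H, x, rfl⟩
    -- For the smallest radical ideal `I` containing `x`, a radical ideal contains `x` exactly when
    -- it contains `I`; so the subbasic open set pulls back to `U(I)`.
    let I : RadicalTambaraIdeal T := sInf {I | x ∈ I.1.level H}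
    refine ⟨I, ?_⟩
    ext p
    refine (p.apply_iff_not_le_kernel I).trans (not_congr ?_)
    have hx : x ∈ I.1.level H := by
      refine mem_sInf_level.2 ?_
      rintro _ ⟨J, hJ, rfl⟩
      exact hJ
    exact ⟨fun h => h H hx, fun h => sInf_le h⟩
  continuous_invFun := by
    refine ⟨?_⟩
    rintro _ ⟨I, rfl⟩
    exact isOpen_not_le I.1

end NakaokaSpectrum

theorem mainTheorem1 {G : Type u} [Group G] [Finite G] (T : TambaraFunctor.{u, v} G) :
    -- the complete lattice of radical Tambara ideals is a frame
    (∀ (I : RadicalTambaraIdeal T) (S : Set (RadicalTambaraIdeal T)),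
      I ⊓ sSup S = ⨆ J ∈ S, I ⊓ J) ∧
    -- the canonical homeomorphism from its point space to the Nakaoka spectrum
    (∃ e : Locale.PT (RadicalTambaraIdeal T) ≃ₜ NakaokaSpectrum T,
      (∀ p : Locale.PT (RadicalTambaraIdeal T),
        (e p).1 = (sSup {I : RadicalTambaraIdeal T | ¬ p I}).1) ∧
      (∀ (P : NakaokaSpectrum T) (I : RadicalTambaraIdeal T), e.symm P I ↔ ¬ I.1 ≤ P.1) ∧
      (∀ I : RadicalTambaraIdeal T,
        e '' {p : Locale.PT (RadicalTambaraIdeal T) | p I} =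
          {P : NakaokaSpectrum T | ¬ I.1 ≤ P.1})) ∧
    -- the meet-prime radical Tambara ideals are exactly the prime Tambara ideals
    (∀ P : TambaraIdeal T,
      P.IsPrime ↔ ∃ h : P.IsRadical, InfPrime (⟨P, h⟩ : RadicalTambaraIdeal T)) := by
  refine ⟨RadicalTambaraIdeal.inf_sSup_eq_iSup, ⟨NakaokaSpectrum.ptHomeomorph T, fun p => rfl,
    fun P I => Iff.rfl, fun I => ?_⟩, RadicalTambaraIdeal.isPrime_iff⟩
  ext P
  rw [← Homeomorph.coe_toEquiv, Equiv.image_eq_preimage_symm]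
  exact Iff.rfl
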